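/- Let $G$ be a connected (possibly infinite) graph. A ray is a one-way infinite path. Two rays of $G$ are equivalent if for every finite vertex set $X$ both have a tail in the same component of $G-X$; the equivalence classes are the ends of $G$. The set $\Omega(G)$ of ends carries the topology generated by the sets of all ends whose rays have a tail in $C$, where $X$ ranges over the finite vertex sets and $C$ over the components of $G-X$. An end is undominated if no ray $R$ in it is dominated by a vertex $v$, i.e. if there is no infinite family of paths that start in $v$, have precisely their last vertex in $R-v$, and pairwise meet only in $v$. A finite-order separation of $G$ is a pair $\{A,B\}$ with $A\cup B=V(G)$, no edge between $A\setminus B$ and $B\setminus A$, and finite separator $A\cap B$; its orientations are $(A,B)$ and $(B,A)$, and $(A,B)\le (C,D)$ means $A\subseteq C$ and $B\supseteq D$. An $S_{\aleph_0}$-tree $(T,\alpha)$ is a tree $T$ with a map $\alpha$ from the oriented edges of $T$ to the oriented finite-order separations of $G$ that commutes with inversion and preserves the natural partial orders. An end $\omega$ of $G$ orients an edge $xy$ of $T$ from $x$ to $y$ if, for $\alpha(x,y)=(A,B)$, every ray in $\omega$ has a tail in $G[B]$. The end $\omega$ lives at a node $t$ of $T$ if it orients all edges at $t$ towards $t$,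 and corresponds to an end $\eta$ of $T$ if for some ray $t_0t_1\dots$ in $\eta$ it orients every edge $t_nt_{n+1}$ from $t_n$ to $t_{n+1}$. Let $\tau\colon\Omega(G)\to\Omega(T)\sqcup V(T)$ map each end of $G$ to the unique end or node of $T$ which it corresponds to or lives at. Then $(T,\alpha)$ displays $\Psi\subseteq\Omega(G)$ if $\tau$ restricts to a bijection $\Psi\to\Omega(T)$ and maps every end outside $\Psi$ to a node of $T$. Proposition 4.4. Let $G$ be a connected graph and let $\Psi\subseteq\Omega(G)$ be a non-empty and compact subspace that consists only of undominated ends. Then there exists an $S_{\aleph_0}$-tree $(T,\alpha)$ such that $T$ is locally finite, every separator $A\cap B$ of $(T,\alpha)$ induces a connected (in particular non-empty) subgraph of $G$, the separators at distinct edges of $T$ are disjoint, and $(T,\alpha)$ displays $\Psi$. -/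

import Mathlib

universe u v

namespace InfGraph

open SimpleGraph

section Rays

variable {V : Type u} {G : SimpleGraph V}

/-- A ray of `G`: a one-way infinite path `R 0, R 1, R 2, …` in `G`. -/
structure Ray (G : SimpleGraph V) where
  vert : ℕ → V
  injective : Function.Injective vert
  adj : ∀ n, G.Adj (vert n) (vert (n + 1))

/-- The ray `R` has a tail all of whose vertices lie in `S`, that is, a tail in `G[S]`. -/
def Ray.HasTailIn (R : Ray G) (S : Set V) : Prop :=
  ∃ n, ∀ m, n ≤ m → R.vert m ∈ S

/-- Two rays are equivalent if for every finite set `X` of vertices both have a tail in the same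
component of `G - X`. -/
def Ray.Equivalent (R R' : Ray G) : Prop :=
  ∀ X : Finset V, ∃ C : G.ComponentCompl (X : Set V),
    R.HasTailIn (C : Set V) ∧ R'.HasTailIn (C : Set V)

theorem Ray.HasTailIn.inter {R : Ray G} {S S' : Set V} (h : R.HasTailIn S)
    (h' : R.HasTailIn S') : R.HasTailIn (S ∩ S') := by
  obtain ⟨n, hn⟩ := h
  obtain ⟨n', hn'⟩ := h'
  exact ⟨max n n', fun m hm =>
    ⟨hn m ((le_max_left _ _).trans hm), hn' m ((le_max_right _ _).trans hm)⟩⟩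

theorem Ray.exists_component (R : Ray G) (X : Finset V) :
    ∃ C : G.ComponentCompl (X : Set V), R.HasTailIn (C : Set V) := by
  have hfin : {n | R.vert n ∈ (X : Set V)}.Finite :=
    X.finite_toSet.preimage R.injective.injOn
  obtain ⟨N, hN⟩ := hfin.bddAbove
  have hX : ∀ m, N + 1 ≤ m → R.vert m ∉ (X : Set V) := fun m hm hmem => by
    have h1 : m ≤ N := hN hmem
    omega
  refine ⟨G.componentComplMk (hX (N + 1) le_rfl), N + 1, fun m hm => ?_⟩
  induction m, hm using Nat.le_induction with
  | base => exact G.componentComplMk_mem _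
  | succ m hm ih =>
    exact ComponentCompl.mem_of_adj _ _ ih (hX _ (Nat.le_succ_of_le hm)) (R.adj m)

theorem Ray.component_unique {R : Ray G} {X : Finset V} {C D : G.ComponentCompl (X : Set V)}
    (hC : R.HasTailIn (C : Set V)) (hD : R.HasTailIn (D : Set V)) : C = D := by
  obtain ⟨n, hn⟩ := hC.inter hD
  by_contra hne
  exact Set.disjoint_iff.mp (ComponentCompl.pairwise_disjoint hne) (hn n le_rfl)

instance raySetoid (G : SimpleGraph V) : Setoid (Ray G) where
  r := Ray.Equivalent
  iseqv :=
    { refl := fun R X => by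
        obtain ⟨C, hC⟩ := R.exists_component X
        exact ⟨C, hC, hC⟩
      symm := fun h X => by
        obtain ⟨C, h1, h2⟩ := h X
        exact ⟨C, h2, h1⟩
      trans := fun h h' X => by
        obtain ⟨C, h1, h2⟩ := h X
        obtain ⟨D, h3, h4⟩ := h' X
        obtain rfl := Ray.component_unique h2 h3
        exact ⟨C, h1, h4⟩ }

/-- The ends of `G`: the equivalence classes of rays of `G`. -/
def GraphEnd (G : SimpleGraph V) : Type u :=
  Quotient (raySetoid G)

/-- The ray `R` belongs to the end `ω`. -/
def GraphEnd.HasRay (ω : GraphEnd G) (R : Ray G) : Prop :=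
  (Quotient.mk (raySetoid G) R : GraphEnd G) = ω

/-- Every ray of the end `ω` has a tail in `G[S]`. -/
def GraphEnd.LivesIn (ω : GraphEnd G) (S : Set V) : Prop :=
  ∀ R : Ray G, ω.HasRay R → R.HasTailIn S

/-- The topology of the end space. It is generated by the sets of all ends that live in `C`, where
`C` is a component of `G - X` and `X` is a finite set of vertices: this is the topology of the
inverse limit of the discrete spaces of components of `G - X`. -/
instance (G : SimpleGraph V) : TopologicalSpace (GraphEnd G) :=
  TopologicalSpace.generateFrom
    {U | ∃ (X : Finset V) (C : G.ComponentCompl (X : Set V)),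
      U = {ω : GraphEnd G | ω.LivesIn (C : Set V)}}

/-- The vertex `v` dominates the ray `R`: there is an infinite `v`–`(R - v)` fan in `G`, that is,
an infinite family of paths that start in `v`, have precisely their last vertex in `R - v`, and
pairwise meet only in `v`. -/
def Dominates (v : V) (R : Ray G) : Prop :=
  ∃ (b : ℕ → V) (P : ∀ n, G.Walk v (b n)),
    (∀ n, (P n).IsPath ∧ ∀ x ∈ (P n).support, x ∈ Set.range R.vert \ {v} ↔ x = b n) ∧
    ∀ m n, m ≠ n → ∀ x, x ∈ (P m).support → x ∈ (P n).support → x = v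

/-- No ray of the end `ω` is dominated by a vertex. -/
def GraphEnd.Undominated (ω : GraphEnd G) : Prop :=
  ∀ R : Ray G, ω.HasRay R → ∀ v : V, ¬ Dominates v R

end Rays

section Separations

variable {V : Type u}

/-- An oriented separation `(A, B)` of `G` of finite order. -/
@[ext]
structure FinSep (G : SimpleGraph V) where
  A : Set V
  B : Set V
  union_eq : A ∪ B = Set.univ
  no_edge : ∀ a ∈ A \ B, ∀ b ∈ B \ A, ¬ G.Adj a b
  finite_order : (A ∩ B).Finite

variable {G : SimpleGraph V}

/-- The inverse `(B, A)` of `(A, B)`. -/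
def FinSep.inv (s : FinSep G) : FinSep G where
  A := s.B
  B := s.A
  union_eq := by rw [Set.union_comm]; exact s.union_eq
  no_edge := fun a ha b hb h => s.no_edge b hb a ha h.symm
  finite_order := by rw [Set.inter_comm]; exact s.finite_order

/-- The partial order on oriented separations: `(A, B) ≤ (C, D)` if `A ⊆ C` and `D ⊆ B`. -/
instance : LE (FinSep G) where
  le s t := s.A ⊆ t.A ∧ t.B ⊆ s.B

/-- The separator `A ∩ B` of `(A, B)`. -/
def FinSep.separator (s : FinSep G) : Set V :=
  s.A ∩ s.B

end Separations

section Trees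

variable {V : Type u} {W : Type v} {G : SimpleGraph V} {T : SimpleGraph W}

/-- The natural partial order on the oriented edges of a tree: `(x, y) ≤ (z, w)` if the two agree
or if the tree contains a path `x, y, …, z, w` (where `y = z` is allowed). -/
def EdgeLE (d d' : T.Dart) : Prop :=
  d = d' ∨ ∃ p : T.Walk d.snd d'.fst, (Walk.cons d.adj (p.concat d'.adj)).IsPath

/-- An `S`-tree `(T, α)` for the set `S` of all finite-order separations of `G`: a tree `T` with a
map `α` from the oriented edges of `T` to the oriented finite-order separations of `G` that
commutes with inversion and preserves the partial order. -/
structure FinSepTree (G : SimpleGraph V) (T : SimpleGraph W) where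
  isTree : T.IsTree
  α : T.Dart → FinSep G
  map_symm : ∀ d, α d.symm = (α d).inv
  map_le : ∀ d d', EdgeLE d d' → α d ≤ α d'

/-- Via `α`, the end `ω` of `G` orients every edge of `T`, towards the side of the corresponding
separation that contains tails of all its rays: it chooses the orientation `d` if, for
`α d = (A, B)`, every ray of `ω` has a tail in `G[B]`. -/
def FinSepTree.Orients (𝒯 : FinSepTree G T) (ω : GraphEnd G) (d : T.Dart) : Prop :=
  ω.LivesIn (𝒯.α d).B

/-- The end `ω` lives at the node `t`: it orients all edges at `t` towards `t`. -/
def FinSepTree.LivesAt (𝒯 : FinSepTree G T) (ω : GraphEnd G) (t : W) : Prop :=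
  ∀ d : T.Dart, d.snd = t → 𝒯.Orients ω d

/-- The end `ω` corresponds to the end `η` of `T`: for some ray `t₀ t₁ …` in `η`, it orients each
edge `tₙ tₙ₊₁` from `tₙ` to `tₙ₊₁`. -/
def FinSepTree.CorrespondsTo (𝒯 : FinSepTree G T) (ω : GraphEnd G) (η : GraphEnd T) : Prop :=
  ∃ R : Ray T, η.HasRay R ∧ ∀ n, 𝒯.Orients ω ⟨(R.vert n, R.vert (n + 1)), R.adj n⟩

/-- `τ` is the map that takes each end of `G` to the end of `T` it corresponds to or to the node of
`T` it lives at, where precisely one end or node of `T` qualifies. -/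
def FinSepTree.IsEndMap (𝒯 : FinSepTree G T) (τ : GraphEnd G → GraphEnd T ⊕ W) : Prop :=
  (∀ ω η, τ ω = Sum.inl η ↔ 𝒯.CorrespondsTo ω η) ∧
  (∀ ω t, τ ω = Sum.inr t ↔ 𝒯.LivesAt ω t)

/-- `(T, α)` displays `Ψ`: the map `τ` restricts to a bijection from `Ψ` to the set of all ends of
`T`, and it takes every end outside `Ψ` to a node of `T`. -/
def FinSepTree.Displays (𝒯 : FinSepTree G T) (Ψ : Set (GraphEnd G)) : Prop :=
  ∃ τ : GraphEnd G → GraphEnd T ⊕ W, 𝒯.IsEndMap τ ∧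
    Set.BijOn τ Ψ (Set.range Sum.inl) ∧ ∀ ω, ω ∉ Ψ → τ ω ∈ Set.range Sum.inr

/-- Every node of `T` has finite degree. -/
def FinSepTree.IsLocallyFinite (_𝒯 : FinSepTree G T) : Prop :=
  ∀ t : W, (T.neighborSet t).Finite

/-- All separators of `(T, α)` induce connected (in particular, non-empty) subgraphs of `G`. -/
def FinSepTree.ConnectedSeparators (𝒯 : FinSepTree G T) : Prop :=
  ∀ d : T.Dart, (G.induce (𝒯.α d).separator).Connected

/-- The separators of `(T, α)` at distinct edges of `T` are disjoint. -/
def FinSepTree.DisjointSeparators (𝒯 : FinSepTree G T) : Prop :=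
  ∀ d d' : T.Dart, d.edge ≠ d'.edge → Disjoint (𝒯.α d).separator (𝒯.α d').separator

end Trees

end InfGraph

/-
The tree is obtained by cutting `G` up recursively. Since `Ψ` is compact and its ends are
undominated, every finite `X` has a finite `Z ⊇ X` such that no component of `G - Z` containing
tails of an end in `Ψ` sends an edge to `X`; the vertices of `Z` in a given component `C` of `G - X`
then extend to a finite connected set `S ⊆ C` that separates `X` from all ends in `Ψ` that live in
`C`. By compactness only finitely many components of `G - S` contain ends in `Ψ`, and the procedure
continues inside each of them. A descending sequence of such components `C₀ ⊋ C₁ ⊋ ⋯` has empty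
intersection: each vertex of `C₁` in the intersection passes this property on to its neighbours in
`C₁`, while `S₁ ⊆ C₁` is disjoint from `C₂`. Hence at most one end lives in all `Cₙ`, and by
compactness such an end exists and lies in `Ψ`.
-/

namespace InfGraph

open SimpleGraph

section Components

variable {V : Type u} {G : SimpleGraph V} {X : Set V}

theorem componentCompl_subset_of_closed (K : G.ComponentCompl X) {U : Set V}
    (hne : ((K : Set V) ∩ U).Nonempty)
    (hU : ∀ a ∈ U, a ∈ (K : Set V) → ∀ b ∈ (K : Set V), G.Adj a b → b ∈ U) :
    (K : Set V) ⊆ U := by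
  obtain ⟨a, ⟨ha, rfl⟩, haU⟩ := hne
  rintro b ⟨hb, hab⟩
  obtain ⟨p⟩ := ConnectedComponent.eq.mp hab.symm
  by_contra hbU
  obtain ⟨d, -, ⟨hdK, hdU⟩, hd⟩ := p.exists_boundary_dart
    {x | (x : V) ∈ G.componentComplMk ha ∧ (x : V) ∈ U}
    ⟨G.componentComplMk_mem ha, haU⟩ (fun h => hbU h.2)
  have hd' : (d.snd : V) ∈ G.componentComplMk ha :=
    ComponentCompl.mem_of_adj _ _ hdK d.snd.2 d.adj
  exact hd ⟨hd', hU _ hdU hdK _ hd' d.adj⟩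

theorem exists_walk_of_mem_componentCompl {K : G.ComponentCompl X} {a b : V}
    (ha : a ∈ (K : Set V)) (hb : b ∈ (K : Set V)) :
    ∃ p : G.Walk a b, ∀ x ∈ p.support, x ∈ (K : Set V) := by
  refine componentCompl_subset_of_closed K
    (U := {b | ∃ p : G.Walk a b, ∀ x ∈ p.support, x ∈ (K : Set V)})
    ⟨a, ha, Walk.nil, by simpa using ha⟩ ?_ hb
  rintro c ⟨p, hp⟩ - d hd hcd
  refine ⟨p.concat hcd, fun x hx => ?_⟩
  rw [Walk.support_concat, List.mem_append, List.mem_singleton] at hx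
  rcases hx with hx | rfl
  · exact hp x hx
  · exact hd

theorem exists_connected_finset_of_componentCompl (K : G.ComponentCompl X)
    (t : Finset V) (ht : (t : Set V) ⊆ K) :
    ∃ S : Finset V, t ⊆ S ∧ (S : Set V) ⊆ K ∧ (G.induce (S : Set V)).Connected := by
  classical
  induction t using Finset.induction_on with
  | empty =>
    obtain ⟨u, hu⟩ := K.nonempty
    refine ⟨{u}, Finset.empty_subset _, by simpa using hu, ?_⟩
    rw [Finset.coe_singleton]
    exact .of_subsingleton
  | insert v t _ ih =>
    rw [Finset.coe_insert, Set.insert_subset_iff] at ht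
    obtain ⟨S, htS, hSK, hS⟩ := ih ht.2
    obtain ⟨u, hu⟩ := hS.nonempty
    obtain ⟨p, hp⟩ := exists_walk_of_mem_componentCompl (hSK hu) ht.1
    have hcoe : ((S ∪ p.support.toFinset : Finset V) : Set V) =
        (S : Set V) ∪ {x | x ∈ p.support} := by
      simp only [Finset.coe_union, List.coe_toFinset]
    refine ⟨S ∪ p.support.toFinset, ?_, hcoe ▸ Set.union_subset hSK hp, hcoe ▸ ?_⟩
    · exact Finset.insert_subset
        (Finset.mem_union_right _ (List.mem_toFinset.mpr p.end_mem_support))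
        (htS.trans Finset.subset_union_left)
    · exact induce_union_connected hS.preconnected p.connected_induce_support.preconnected
        ⟨u, hu, p.start_mem_support⟩

theorem exists_isPath_first_hit {B : Set V} {u v : V} (p : G.Walk u v) (hv : v ∈ B) :
    ∃ b ∈ B, ∃ q : G.Walk u b, q.IsPath ∧ q.support ⊆ p.support ∧
      ∀ z ∈ q.support, z ∈ B → z = b := by
  classical
  obtain ⟨b, hb, hbp, hfirst⟩ := p.exists_mem_support_forall_mem_support_imp_eq
    {x ∈ p.support.toFinset | x ∈ B} ⟨v, by simp [hv]⟩
  have hsub : (p.takeUntil b hbp).bypass.support ⊆ (p.takeUntil b hbp).support :=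
    (p.takeUntil b hbp).support_bypass_subset_support
  have hsub' := List.Subset.trans hsub (p.support_takeUntil_subset_support hbp)
  refine ⟨b, (Finset.mem_filter.mp hb).2, _, (p.takeUntil b hbp).bypass_isPath, hsub',
    fun z hz hzB => hfirst z ?_ (hsub hz)⟩
  exact Finset.mem_filter.mpr ⟨List.mem_toFinset.mpr (hsub' hz), hzB⟩

end Components

section Ends

variable {V : Type u} {G : SimpleGraph V}

theorem Ray.HasTailIn.mono {R : Ray G} {S S' : Set V} (h : R.HasTailIn S) (hS : S ⊆ S') :
    R.HasTailIn S' := by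
  obtain ⟨n, hn⟩ := h
  exact ⟨n, fun m hm => hS (hn m hm)⟩

namespace GraphEnd

variable {ω ω' : GraphEnd G} {S S' : Set V}

theorem exists_ray (ω : GraphEnd G) : ∃ R, ω.HasRay R := Quotient.exists_rep ω

theorem livesIn_univ (ω : GraphEnd G) : ω.LivesIn Set.univ :=
  fun _ _ => ⟨0, fun _ _ => Set.mem_univ _⟩

theorem LivesIn.mono (h : ω.LivesIn S) (hS : S ⊆ S') : ω.LivesIn S' :=
  fun R hR => (h R hR).mono hS

theorem LivesIn.inter (h : ω.LivesIn S) (h' : ω.LivesIn S') : ω.LivesIn (S ∩ S') :=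
  fun R hR => (h R hR).inter (h' R hR)

theorem LivesIn.nonempty (h : ω.LivesIn S) : S.Nonempty := by
  obtain ⟨R, hR⟩ := ω.exists_ray
  obtain ⟨n, hn⟩ := h R hR
  exact ⟨_, hn n le_rfl⟩

theorem exists_component (ω : GraphEnd G) (X : Finset V) :
    ∃ C : G.ComponentCompl (X : Set V), ω.LivesIn (C : Set V) := by
  obtain ⟨R, hR⟩ := ω.exists_ray
  obtain ⟨C, hC⟩ := R.exists_component X
  refine ⟨C, fun R' hR' => ?_⟩
  have hRR' : Ray.Equivalent R R' := Quotient.exact (hR.trans hR'.symm)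
  obtain ⟨D, hD, hD'⟩ := hRR' X
  obtain rfl := Ray.component_unique hC hD
  exact hD'

theorem component_unique {X : Finset V} {C D : G.ComponentCompl (X : Set V)}
    (hC : ω.LivesIn (C : Set V)) (hD : ω.LivesIn (D : Set V)) : C = D := by
  obtain ⟨R, hR⟩ := ω.exists_ray
  exact Ray.component_unique (hC R hR) (hD R hR)

theorem component_subset_component {X Z : Finset V} (hXZ : X ⊆ Z)
    {C : G.ComponentCompl (X : Set V)} {E : G.ComponentCompl (Z : Set V)}
    (hC : ω.LivesIn (C : Set V)) (hE : ω.LivesIn (E : Set V)) : (E : Set V) ⊆ C :=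
  have h := Finset.coe_subset.mpr hXZ
  (E.hom_eq_iff_le h C).mp (component_unique (hE.mono (E.subset_hom h)) hC)

theorem not_livesIn_finset (X : Finset V) : ¬ ω.LivesIn (X : Set V) := by
  intro h
  obtain ⟨C, hC⟩ := ω.exists_component X
  obtain ⟨x, hx, hx'⟩ := (h.inter hC).nonempty
  exact ComponentCompl.notMem_of_mem hx' hx

theorem eq_of_forall_component
    (h : ∀ X : Finset V, ∃ C : G.ComponentCompl (X : Set V),
      ω.LivesIn (C : Set V) ∧ ω'.LivesIn (C : Set V)) : ω = ω' := by
  obtain ⟨R, hR⟩ := ω.exists_ray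
  obtain ⟨R', hR'⟩ := ω'.exists_ray
  rw [← hR, ← hR']
  refine Quotient.sound fun X => ?_
  obtain ⟨C, h1, h2⟩ := h X
  exact ⟨C, h1 R hR, h2 R' hR'⟩

end GraphEnd

theorem FinSep.livesIn_or (s : FinSep G) (ω : GraphEnd G) : ω.LivesIn s.A ∨ ω.LivesIn s.B := by
  obtain ⟨C, hC⟩ := ω.exists_component s.finite_order.toFinset
  have hC_avoids : ∀ x ∈ (C : Set V), ¬ (x ∈ s.A ∧ x ∈ s.B) := fun x hx hAB =>
    ComponentCompl.notMem_of_mem hx (by simpa using hAB)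
  have hcover : ∀ x, x ∈ s.A ∨ x ∈ s.B := fun x => by
    simpa [← s.union_eq] using Set.mem_univ x
  by_cases h : ((C : Set V) ∩ s.A).Nonempty
  · refine Or.inl (hC.mono (componentCompl_subset_of_closed C h fun a haA haC b _ hab => ?_))
    by_contra hbA
    exact s.no_edge a ⟨haA, fun haB => hC_avoids a haC ⟨haA, haB⟩⟩ b
      ⟨(hcover b).resolve_left hbA, hbA⟩ hab
  · exact Or.inr (hC.mono fun x hx => (hcover x).resolve_left fun hxA => h ⟨x, hx, hxA⟩)

theorem FinSep.not_livesIn_both (s : FinSep G) {ω : GraphEnd G} (hA : ω.LivesIn s.A)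
    (hB : ω.LivesIn s.B) : False :=
  GraphEnd.not_livesIn_finset (ω := ω) s.finite_order.toFinset (by simpa using hA.inter hB)

end Ends

section Regions

variable {V : Type u} {G : SimpleGraph V} {Ψ : Set (GraphEnd G)}

variable (G) in
/-- The region of `G` cut out by a finite set of vertices: `C` is the vertex set of a component of
`G - X` for some finite `X`. The ends living in the regions form the basic open sets of the end
space. -/
def IsRegion (C : Set V) : Prop :=
  ∃ (X : Finset V) (K : G.ComponentCompl (X : Set V)), (K : Set V) = C

theorem isOpen_livesIn {C : Set V} (hC : IsRegion G C) :
    IsOpen {ω : GraphEnd G | ω.LivesIn C} := by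
  obtain ⟨X, K, rfl⟩ := hC
  exact TopologicalSpace.isOpen_generateFrom_of_mem ⟨X, K, rfl⟩

theorem isClosed_livesIn {C : Set V} (hC : IsRegion G C) :
    IsClosed {ω : GraphEnd G | ω.LivesIn C} := by
  obtain ⟨X, C, rfl⟩ := hC
  have hcompl : {ω : GraphEnd G | ω.LivesIn (C : Set V)}ᶜ =
      ⋃ D ∈ {D : G.ComponentCompl (X : Set V) | D ≠ C},
        {ω : GraphEnd G | ω.LivesIn (D : Set V)} := by
    ext ω
    simp only [Set.mem_compl_iff, Set.mem_ofPred_eq, Set.mem_iUnion, exists_prop]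
    constructor
    · intro h
      obtain ⟨D, hD⟩ := ω.exists_component X
      exact ⟨D, fun hDC => h (hDC ▸ hD), hD⟩
    · rintro ⟨D, hne, hD⟩ hC
      exact hne (GraphEnd.component_unique hD hC)
  rw [← isOpen_compl_iff, hcompl]
  exact isOpen_biUnion fun D _ => isOpen_livesIn ⟨X, D, rfl⟩

theorem finite_setOf_component_livesIn (hcpt : IsCompact Ψ) (S : Finset V) :
    {D : G.ComponentCompl (S : Set V) | ∃ ω ∈ Ψ, ω.LivesIn (D : Set V)}.Finite := by
  obtain ⟨t, ht⟩ := hcpt.elim_finite_subcover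
    (fun D : G.ComponentCompl (S : Set V) => {ω : GraphEnd G | ω.LivesIn (D : Set V)})
    (fun D => isOpen_livesIn ⟨S, D, rfl⟩)
    (fun ω _ => Set.mem_iUnion.mpr (ω.exists_component S))
  refine t.finite_toSet.subset ?_
  rintro D ⟨ω, hω, hD⟩
  obtain ⟨i, hi, hωi⟩ := Set.mem_iUnion₂.mp (ht hω)
  exact GraphEnd.component_unique hD hωi ▸ hi

theorem exists_end_livesIn_antitone (hcpt : IsCompact Ψ) {C : ℕ → Set V}
    (hC : ∀ n, IsRegion G (C n)) (hmono : Antitone C) (hne : ∀ n, ∃ ω ∈ Ψ, ω.LivesIn (C n)) :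
    ∃ ω ∈ Ψ, ∀ n, ω.LivesIn (C n) := by
  by_contra! hcon
  obtain ⟨n, hn⟩ := hcpt.elim_directed_cover (fun n => {ω : GraphEnd G | ω.LivesIn (C n)}ᶜ)
    (fun n => (isClosed_livesIn (hC n)).isOpen_compl)
    (fun ω hω => Set.mem_iUnion.mpr (hcon ω hω))
    (directed_of_isDirected_le fun m n hmn ω hω h => hω (h.mono (hmono hmn)))
  obtain ⟨ω, hω, hlive⟩ := hne n
  exact hn hω hlive

theorem end_unique_of_iInter_eq_empty {C : ℕ → Set V} (hC : ∀ n, IsRegion G (C n))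
    (hmono : Antitone C) (hempty : ⋂ n, C n = ∅) {ω ω' : GraphEnd G}
    (hω : ∀ n, ω.LivesIn (C n)) (hω' : ∀ n, ω'.LivesIn (C n)) : ω = ω' := by
  refine GraphEnd.eq_of_forall_component fun X => ?_
  have havoid : ∀ v, ∃ n, v ∉ C n := by simpa [Set.eq_empty_iff_forall_notMem] using hempty
  choose N hN using havoid
  let n := X.sup N
  have hX : ∀ x ∈ X, x ∉ C n := fun x hx h => hN x (hmono (Finset.le_sup hx) h)
  obtain ⟨D, hD⟩ := ω.exists_component X
  obtain ⟨Y, K, hK⟩ := hC n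
  have hCD : C n ⊆ D := by
    rw [← hK]
    refine componentCompl_subset_of_closed K ?_ fun a haD _ b hbK hab =>
      ComponentCompl.mem_of_adj a b haD (fun hb => hX b hb (hK ▸ hbK)) hab
    exact hK ▸ ((hω n).inter hD).nonempty
  exact ⟨D, hD, (hω' n).mono hCD⟩

end Regions

section Undominated

variable {V : Type u} {G : SimpleGraph V} {ω : GraphEnd G} {Ψ : Set (GraphEnd G)}

theorem exists_isPath_to_ray {R : Ray G} (hR : ω.HasRay R) {x : V} {Y : Finset V}
    {C : G.ComponentCompl (Y : Set V)} (hC : ω.LivesIn (C : Set V)) (hx : x ∈ (C : Set V)) :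
    ∃ b, ∃ p : G.Walk x b, p.IsPath ∧
      (∀ z ∈ p.support, z ∈ Set.range R.vert \ {x} ↔ z = b) ∧ ∀ z ∈ p.support, z ∉ Y := by
  obtain ⟨n, hn⟩ := hC R hR
  obtain ⟨m, hm, hmx⟩ : ∃ m, n ≤ m ∧ R.vert m ≠ x := by
    by_cases h : R.vert n = x
    · exact ⟨n + 1, n.le_succ, fun h' => by simpa using R.injective (h'.trans h.symm)⟩
    · exact ⟨n, le_rfl, h⟩
  obtain ⟨w, hw⟩ := exists_walk_of_mem_componentCompl hx (hn m hm)
  obtain ⟨b, hb, p, hp, hpw, hpb⟩ :=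
    exists_isPath_first_hit w (B := Set.range R.vert \ {x}) ⟨⟨m, rfl⟩, hmx⟩
  exact ⟨b, p, hp, fun z hz => ⟨hpb z hz, fun h => h ▸ hb⟩,
    fun z hz => ComponentCompl.notMem_of_mem (hw z (hpw hz))⟩

theorem dominates_of_forall_mem_component {R : Ray G} (hR : ω.HasRay R) {x : V}
    (h : ∀ (Y : Finset V) (C : G.ComponentCompl (Y : Set V)), x ∉ Y → ω.LivesIn (C : Set V) →
      x ∈ (C : Set V)) : Dominates x R := by
  classical
  obtain ⟨f, hf, hdisj⟩ := exists_seq_of_forall_finset_exists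
    (α := Σ b : V, G.Walk x b)
    (fun q => q.2.IsPath ∧ ∀ z ∈ q.2.support, z ∈ Set.range R.vert \ {x} ↔ z = q.1)
    (fun q q' => ∀ z, z ∈ q.2.support → z ∈ q'.2.support → z = x) (by
      intro s _
      let Y : Finset V := (s.biUnion fun q => q.2.support.toFinset).erase x
      obtain ⟨C, hC⟩ := ω.exists_component Y
      obtain ⟨b, p, hp, hpb, hpY⟩ :=
        exists_isPath_to_ray hR hC (h Y C (Finset.notMem_erase x _) hC)
      refine ⟨⟨b, p⟩, ⟨hp, hpb⟩, fun q hq z hz hzp => ?_⟩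
      by_contra hzx
      exact hpY z hzp (Finset.mem_erase.mpr
        ⟨hzx, Finset.mem_biUnion.mpr ⟨q, hq, List.mem_toFinset.mpr hz⟩⟩))
  refine ⟨fun n => (f n).1, fun n => (f n).2, hf, fun m n hmn z hz hz' => ?_⟩
  rcases lt_or_gt_of_ne hmn with hlt | hlt
  · exact hdisj m n hlt z hz hz'
  · exact hdisj n m hlt z hz' hz

theorem GraphEnd.Undominated.exists_finset_not_adj (hω : ω.Undominated) (X : Finset V) :
    ∃ (Z : Finset V) (C : G.ComponentCompl (Z : Set V)),
      ω.LivesIn (C : Set V) ∧ ∀ x ∈ X, ∀ c ∈ (C : Set V), ¬ G.Adj x c := by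
  classical
  obtain ⟨R, hR⟩ := ω.exists_ray
  have hsep : ∀ x : V, ∃ (Y : Finset V) (C : G.ComponentCompl (Y : Set V)), x ∉ Y ∧
      ω.LivesIn (C : Set V) ∧ x ∉ (C : Set V) := by
    intro x
    by_contra! hcon
    exact hω R hR x (dominates_of_forall_mem_component hR hcon)
  choose Y D hxY hD hxD using hsep
  obtain ⟨C, hC⟩ := ω.exists_component (X.biUnion Y)
  refine ⟨_, C, hC, fun x hx c hc hadj => hxD x ?_⟩
  have hCD := component_subset_component (Finset.subset_biUnion_of_mem Y hx) (hD x) hC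
  exact ComponentCompl.mem_of_adj c x (hCD hc) (hxY x) hadj.symm

theorem exists_finset_forall_not_adj (hcpt : IsCompact Ψ) (hund : ∀ ω ∈ Ψ, ω.Undominated)
    (X : Finset V) : ∃ Z : Finset V, X ⊆ Z ∧ ∀ ω ∈ Ψ, ∀ C : G.ComponentCompl (Z : Set V),
      ω.LivesIn (C : Set V) → ∀ x ∈ X, ∀ c ∈ (C : Set V), ¬ G.Adj x c := by
  classical
  choose Z C hC hadj using fun ω : Ψ => (hund ω ω.2).exists_finset_not_adj X
  obtain ⟨t, ht⟩ := hcpt.elim_finite_subcover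
    (fun ω : Ψ => {ω' : GraphEnd G | ω'.LivesIn (C ω : Set V)})
    (fun ω => isOpen_livesIn ⟨Z ω, C ω, rfl⟩)
    (fun ω hω => Set.mem_iUnion.mpr ⟨⟨ω, hω⟩, hC ⟨ω, hω⟩⟩)
  refine ⟨X ∪ t.biUnion Z, Finset.subset_union_left, fun ω hω D hD x hx c hc => ?_⟩
  obtain ⟨i, hi, hωi⟩ := Set.mem_iUnion₂.mp (ht hω)
  have hZ : Z i ⊆ X ∪ t.biUnion Z :=
    (Finset.subset_biUnion_of_mem Z hi).trans Finset.subset_union_right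
  exact hadj i x hx c (GraphEnd.component_subset_component hZ hωi hD hc)

theorem component_subset_of_not_adj {X Z S : Finset V} (hXZ : X ⊆ Z)
    {K : G.ComponentCompl (X : Set V)} (hωK : ω.LivesIn (K : Set V))
    (hZS : ∀ z ∈ Z, z ∈ (K : Set V) → z ∈ S)
    (hadj : ∀ C : G.ComponentCompl (Z : Set V), ω.LivesIn (C : Set V) →
      ∀ x ∈ X, ∀ c ∈ (C : Set V), ¬ G.Adj x c)
    {D : G.ComponentCompl (S : Set V)} (hD : ω.LivesIn (D : Set V)) : (D : Set V) ⊆ K := by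
  classical
  obtain ⟨C, hC⟩ := ω.exists_component Z
  obtain ⟨E, hE⟩ := ω.exists_component (Z ∪ S)
  have hEC : (E : Set V) ⊆ C := GraphEnd.component_subset_component Finset.subset_union_left hC hE
  have hEK : (E : Set V) ⊆ K :=
    GraphEnd.component_subset_component (hXZ.trans Finset.subset_union_left) hωK hE
  suffices hDE : (D : Set V) ⊆ E from hDE.trans hEK
  refine componentCompl_subset_of_closed D (hD.inter hE).nonempty fun a haE _ b hbD hab => ?_
  have hbS : b ∉ S := ComponentCompl.notMem_of_mem hbD
  suffices hbZ : b ∉ Z from ComponentCompl.mem_of_adj a b haE (by simp [hbZ, hbS]) hab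
  intro hbZ
  have hbX : b ∈ X := by
    by_contra hbX
    exact hbS (hZS b hbZ (ComponentCompl.mem_of_adj a b (hEK haE) hbX hab))
  exact hadj C hC b hbX a (hEC haE) hab.symm

theorem exists_connected_finset_separating (hcpt : IsCompact Ψ)
    (hund : ∀ ω ∈ Ψ, ω.Undominated) {C : Set V} (hC : IsRegion G C) :
    ∃ S : Finset V, (S : Set V) ⊆ C ∧ (G.induce (S : Set V)).Connected ∧
      ∀ ω ∈ Ψ, ω.LivesIn C →
        ∃ D : G.ComponentCompl (S : Set V), (D : Set V) ⊆ C ∧ ω.LivesIn (D : Set V) := by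
  classical
  obtain ⟨X, K, rfl⟩ := hC
  obtain ⟨Z, hXZ, hZ⟩ := exists_finset_forall_not_adj hcpt hund X
  obtain ⟨S, hZS, hSK, hS⟩ := exists_connected_finset_of_componentCompl K {z ∈ Z | z ∈ (K : Set V)}
    (fun z hz => (Finset.mem_filter.mp hz).2)
  refine ⟨S, hSK, hS, fun ω hω hωK => ?_⟩
  obtain ⟨D, hD⟩ := ω.exists_component S
  exact ⟨D, component_subset_of_not_adj hXZ hωK
    (fun z hz hzK => hZS (Finset.mem_filter.mpr ⟨hz, hzK⟩)) (hZ ω hω) hD, hD⟩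

end Undominated

section TreeRays

variable {V : Type u} {G : SimpleGraph V}

theorem Ray.equivalent_of_eventually_eq {R R' : Ray G} {m n : ℕ}
    (h : ∀ k, R.vert (m + k) = R'.vert (n + k)) : Ray.Equivalent R R' := by
  intro X
  obtain ⟨C, N, hN⟩ := R.exists_component X
  refine ⟨C, ⟨N, hN⟩, n + N, fun j hj => ?_⟩
  obtain ⟨k, rfl⟩ := Nat.exists_eq_add_of_le (show n ≤ j by omega)
  rw [← h]
  exact hN _ (by omega)

theorem exists_walk_of_forall_adj {c : ℕ → V} (hadj : ∀ n, G.Adj (c n) (c (n + 1))) (m k : ℕ) :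
    ∃ p : G.Walk (c m) (c (m + k)),
      p.edges = (List.range k).map fun i => s(c (m + i), c (m + i + 1)) := by
  induction k with
  | zero => exact ⟨Walk.nil, rfl⟩
  | succ k ih =>
    obtain ⟨p, hp⟩ := ih
    refine ⟨p.concat (hadj (m + k)), ?_⟩
    rw [Walk.edges_concat, hp, List.range_succ, List.map_append, List.concat_eq_append]
    rfl

theorem injective_of_forall_adj_of_ne (hG : G.IsAcyclic) {c : ℕ → V}
    (hadj : ∀ n, G.Adj (c n) (c (n + 1))) (hne : ∀ n, c (n + 2) ≠ c n) :
    Function.Injective c := by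
  suffices h : ∀ m k, c m = c (m + k) → k = 0 by
    intro m n hmn
    rcases le_total m n with hle | hle
    all_goals
      obtain ⟨k, rfl⟩ := Nat.exists_eq_add_of_le hle
    · rw [h m k hmn, add_zero]
    · rw [h n k hmn.symm, add_zero]
  intro m k hmk
  obtain ⟨p, hp⟩ := exists_walk_of_forall_adj hadj m k
  have hpath : p.IsPath := by
    rw [hG.isPath_iff_isChain, hp, List.isChain_map]
    refine (List.isChain_range _ k).mpr fun i _ heq => ?_
    rcases Sym2.eq_iff.mp heq with ⟨h, -⟩ | ⟨h, -⟩
    · exact (hadj (m + i)).ne h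
    · exact hne (m + i) h.symm
  have hnil : (p.copy rfl hmk.symm).Nil :=
    Walk.isPath_iff_nil.mp ((Walk.isPath_copy p rfl hmk.symm).mpr hpath)
  calc k = p.length := by simpa using (congrArg List.length hp).symm
    _ = 0 := ((Walk.nil_copy rfl hmk.symm).mp hnil).length_eq_zero

/-- The tail of a ray from its `n`-th vertex on. -/
def Ray.tail (R : Ray G) (n : ℕ) : Ray G where
  vert k := R.vert (n + k)
  injective := R.injective.comp (add_right_injective n)
  adj k := R.adj (n + k)

theorem Ray.exists_eventually_eq_of_preconnected (hG : G.Preconnected) (R : Ray G) (v : V) :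
    ∃ R' : Ray G, R'.vert 0 = v ∧ ∃ m n, ∀ k, R.vert (m + k) = R'.vert (n + k) := by
  obtain ⟨p⟩ := hG v (R.vert 0)
  generalize hx : R.vert 0 = x at p
  induction p with
  | nil => exact ⟨R, hx, 0, 0, fun _ => rfl⟩
  | @cons v w x hvw p ih =>
    obtain ⟨R', rfl, m, n, hR'⟩ := ih hx
    by_cases hv : ∃ i, R'.vert i = v
    · obtain ⟨i, rfl⟩ := hv
      refine ⟨R'.tail i, rfl, m + i, n, fun k => ?_⟩
      rw [add_assoc, hR']
      exact congrArg R'.vert (by omega)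
    · push Not at hv
      let R'' : Ray G :=
        { vert := fun | 0 => v | k + 1 => R'.vert k
          injective := by
            rintro (_ | i) (_ | j) hij
            · rfl
            · exact absurd hij.symm (hv j)
            · exact absurd hij (hv i)
            · exact congrArg (· + 1) (R'.injective hij)
          adj := fun | 0 => hvw | k + 1 => R'.adj k }
      refine ⟨R'', rfl, m, n + 1, fun k => ?_⟩
      rw [hR', add_right_comm]

theorem Ray.succ_mem_component {R : Ray G} {n : ℕ} {v : V} (hv : R.vert n = v)
    {C : G.ComponentCompl (({v} : Finset V) : Set V)} (hC : R.HasTailIn (C : Set V)) :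
    R.vert (n + 1) ∈ (C : Set V) := by
  have havoid : ∀ m, n < m → R.vert m ∉ (({v} : Finset V) : Set V) :=
    fun m hm h => hm.ne' (R.injective (hv ▸ by simpa using h))
  obtain ⟨N, hN⟩ := hC
  by_contra hn
  have hout : ∀ m, n < m → R.vert m ∉ (C : Set V) := by
    intro m hm
    induction m, hm using Nat.le_induction with
    | base => exact hn
    | succ m hm ih =>
      exact fun h => ih (ComponentCompl.mem_of_adj _ _ h (havoid m hm) (R.adj m).symm)
  exact hout (max N (n + 1)) (by omega) (hN _ (le_max_left _ _))

theorem eq_of_adj_of_mem_component (hG : G.IsAcyclic) {v a b : V}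
    {C : G.ComponentCompl (({v} : Finset V) : Set V)} (hva : G.Adj v a) (hvb : G.Adj v b)
    (ha : a ∈ (C : Set V)) (hb : b ∈ (C : Set V)) : a = b := by
  classical
  obtain ⟨p, hp⟩ := exists_walk_of_mem_componentCompl ha hb
  have hv : v ∉ p.bypass.support := fun h =>
    ComponentCompl.notMem_of_mem (hp v (p.support_bypass_subset_support h)) (by simp)
  have hpath : (Walk.cons hva p.bypass).IsPath := p.bypass_isPath.cons hv
  have hb_mem : b ∈ (Walk.cons hva p.bypass).support := Walk.end_mem_support _
  simpa using (hG.eq_snd_of_adj_start hpath hvb hb_mem).symm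

theorem Ray.Equivalent.vert_eq_of_isAcyclic (hG : G.IsAcyclic) {R R' : Ray G}
    (h : R.Equivalent R') (h0 : R.vert 0 = R'.vert 0) (n : ℕ) : R.vert n = R'.vert n := by
  induction n with
  | zero => exact h0
  | succ n ih =>
    obtain ⟨C, hC, hC'⟩ := h {R.vert n}
    exact eq_of_adj_of_mem_component hG (R.adj n) (ih ▸ R'.adj n)
      (R.succ_mem_component rfl hC) (R'.succ_mem_component ih.symm hC')

theorem Ray.Equivalent.exists_eventually_eq (hG : G.IsTree) {R R' : Ray G}
    (h : R.Equivalent R') : ∃ m n, ∀ k, R.vert (m + k) = R'.vert (n + k) := by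
  obtain ⟨Q, hQ, m, n, hRQ⟩ :=
    R.exists_eventually_eq_of_preconnected hG.connected.preconnected (R'.vert 0)
  have hQR' : Q.Equivalent R' :=
    (raySetoid G).trans ((raySetoid G).symm (Ray.equivalent_of_eventually_eq hRQ)) h
  exact ⟨m, n, fun k => (hRQ k).trans (hQR'.vert_eq_of_isAcyclic hG.isAcyclic hQ (n + k))⟩

end TreeRays

section EndMap

variable {V : Type u} {W : Type v} {G : SimpleGraph V} {T : SimpleGraph W}

theorem edgeLE_of_adj_of_adj {x y z : W} (hxy : T.Adj x y) (hyz : T.Adj y z) (hne : x ≠ z) :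
    EdgeLE (T := T) ⟨(x, y), hxy⟩ ⟨(y, z), hyz⟩ :=
  Or.inr ⟨Walk.nil, by simp [Walk.concat_eq_append, hxy.ne, hyz.ne, hne]⟩

theorem exists_hasRay_vert_zero_eq (hT : T.Preconnected) (η : GraphEnd T) (t : W) :
    ∃ R : Ray T, η.HasRay R ∧ R.vert 0 = t := by
  obtain ⟨R, hR⟩ := η.exists_ray
  obtain ⟨R', hR', m, n, hRR'⟩ := R.exists_eventually_eq_of_preconnected hT t
  exact ⟨R', (Quotient.sound (Ray.equivalent_of_eventually_eq fun k => (hRR' k).symm)).trans hR,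
    hR'⟩

namespace FinSepTree

variable {𝒯 : FinSepTree G T} {ω : GraphEnd G} {η η' : GraphEnd T} {t t' x y z : W}

theorem orients_symm_iff {d : T.Dart} : 𝒯.Orients ω d.symm ↔ ω.LivesIn (𝒯.α d).A := by
  rw [Orients, 𝒯.map_symm]
  rfl

theorem orients_or_orients_symm (d : T.Dart) : 𝒯.Orients ω d ∨ 𝒯.Orients ω d.symm :=
  ((𝒯.α d).livesIn_or ω).symm.imp_right orients_symm_iff.mpr

theorem Orients.not_symm {d : T.Dart} (h : 𝒯.Orients ω d) : ¬ 𝒯.Orients ω d.symm :=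
  fun h' => (𝒯.α d).not_livesIn_both (orients_symm_iff.mp h') h

theorem Orients.ne {hxy : T.Adj x y} {hyz : T.Adj y z} (h : 𝒯.Orients ω ⟨(x, y), hxy⟩)
    (h' : 𝒯.Orients ω ⟨(y, z), hyz⟩) : x ≠ z := by
  rintro rfl
  exact h.not_symm h'

theorem Orients.congr {x' y' : W} {hxy : T.Adj x y} {hxy' : T.Adj x' y'}
    (h : 𝒯.Orients ω ⟨(x, y), hxy⟩) (hx : x = x') (hy : y = y') :
    𝒯.Orients ω ⟨(x', y'), hxy'⟩ := by
  subst hx hy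
  exact h

theorem Orients.of_consecutive {hxy : T.Adj x y} {hyz : T.Adj y z}
    (h : 𝒯.Orients ω ⟨(y, z), hyz⟩) (hne : x ≠ z) : 𝒯.Orients ω ⟨(x, y), hxy⟩ :=
  h.mono (𝒯.map_le _ _ (edgeLE_of_adj_of_adj hxy hyz hne)).2

theorem Orients.unique {hxy : T.Adj x y} {hxz : T.Adj x z} (hy : 𝒯.Orients ω ⟨(x, y), hxy⟩)
    (hz : 𝒯.Orients ω ⟨(x, z), hxz⟩) : y = z := by
  by_contra hne
  exact hy.not_symm (hz.of_consecutive (hxy := hxy.symm) hne)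

theorem LivesAt.not_orients (h : 𝒯.LivesAt ω t) (hty : T.Adj t y) :
    ¬ 𝒯.Orients ω ⟨(t, y), hty⟩ :=
  (h ⟨(y, t), hty.symm⟩ rfl).not_symm

theorem LivesAt.orients_of_isPath (h : 𝒯.LivesAt ω t) {hxy : T.Adj x y} {p : T.Walk y t}
    (hp : (Walk.cons hxy p).IsPath) : 𝒯.Orients ω ⟨(x, y), hxy⟩ := by
  induction p generalizing x with
  | nil => exact h _ rfl
  | cons hyz p ih =>
    refine (ih h hp.of_cons).of_consecutive ?_
    rintro rfl
    exact ((Walk.cons_isPath_iff _ _).mp hp).2 (by simp)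

theorem LivesAt.unique (h : 𝒯.LivesAt ω t) (h' : 𝒯.LivesAt ω t') : t = t' := by
  obtain ⟨p, hp⟩ := 𝒯.isTree.connected.exists_isPath t t'
  cases p with
  | nil => rfl
  | cons hty p => exact absurd (h'.orients_of_isPath hp) (h.not_orients hty)

theorem Orients.of_le {R : Ray T} {m n : ℕ} (hmn : m ≤ n)
    (h : 𝒯.Orients ω ⟨(R.vert n, R.vert (n + 1)), R.adj n⟩) :
    𝒯.Orients ω ⟨(R.vert m, R.vert (m + 1)), R.adj m⟩ := by
  induction n, hmn using Nat.le_induction with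
  | base => exact h
  | succ n _ ih => exact ih (h.of_consecutive fun heq => by have := R.injective heq; omega)

theorem CorrespondsTo.orients (h : 𝒯.CorrespondsTo ω η) {R : Ray T} (hR : η.HasRay R) (n : ℕ) :
    𝒯.Orients ω ⟨(R.vert n, R.vert (n + 1)), R.adj n⟩ := by
  obtain ⟨R', hR', hω⟩ := h
  have hequiv : R.Equivalent R' := Quotient.exact (hR.trans hR'.symm)
  obtain ⟨m, k, hmk⟩ := hequiv.exists_eventually_eq 𝒯.isTree
  refine Orients.of_le (Nat.le_add_left n m) ?_
  exact (hω (k + n)).congr (hmk n).symm (hmk (n + 1)).symm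

theorem CorrespondsTo.not_livesAt (h : 𝒯.CorrespondsTo ω η) (t : W) : ¬ 𝒯.LivesAt ω t := by
  obtain ⟨R, hR, rfl⟩ := exists_hasRay_vert_zero_eq 𝒯.isTree.connected.preconnected η t
  exact fun ht => ht.not_orients (R.adj 0) (h.orients hR 0)

theorem CorrespondsTo.unique (h : 𝒯.CorrespondsTo ω η) (h' : 𝒯.CorrespondsTo ω η') : η = η' := by
  obtain ⟨R, hR⟩ := η.exists_ray
  obtain ⟨R', hR', h0⟩ :=
    exists_hasRay_vert_zero_eq 𝒯.isTree.connected.preconnected η' (R.vert 0)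
  have heq : ∀ n, R.vert n = R'.vert n := by
    intro n
    induction n with
    | zero => exact h0.symm
    | succ n ih =>
      have hadj : T.Adj (R.vert n) (R'.vert (n + 1)) := ih ▸ R'.adj n
      refine (h.orients hR n).unique (hxz := hadj) ?_
      exact (h'.orients hR' n).congr ih.symm rfl
  rw [← hR, ← hR']
  exact Quotient.sound (Ray.equivalent_of_eventually_eq (m := 0) (n := 0) fun k => heq (0 + k))

theorem exists_orients_of_not_livesAt (h : ¬ 𝒯.LivesAt ω t) :
    ∃ (y : W) (hty : T.Adj t y), 𝒯.Orients ω ⟨(t, y), hty⟩ := by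
  rw [LivesAt] at h
  push Not at h
  obtain ⟨d, rfl, hd⟩ := h
  exact ⟨d.fst, d.adj.symm, (orients_or_orients_symm d).resolve_left hd⟩

theorem exists_correspondsTo_of_forall_not_livesAt (h : ∀ t, ¬ 𝒯.LivesAt ω t) :
    ∃ η, 𝒯.CorrespondsTo ω η := by
  choose f hadj hf using fun t => exists_orients_of_not_livesAt (h t)
  obtain ⟨t⟩ := 𝒯.isTree.connected.nonempty
  let c : ℕ → W := fun n => f^[n] t
  have hc : ∀ n, c (n + 1) = f (c n) := fun n => Function.iterate_succ_apply' f n t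
  have hcadj : ∀ n, T.Adj (c n) (c (n + 1)) := fun n => hc n ▸ hadj (c n)
  have horients : ∀ n, 𝒯.Orients ω ⟨(c n, c (n + 1)), hcadj n⟩ :=
    fun n => (hf (c n)).congr rfl (hc n).symm
  have hne : ∀ n, c (n + 2) ≠ c n := fun n =>
    ((horients n).ne (horients (n + 1))).symm
  let R : Ray T := ⟨c, injective_of_forall_adj_of_ne 𝒯.isTree.isAcyclic hcadj hne, hcadj⟩
  exact ⟨Quotient.mk _ R, R, rfl, horients⟩

theorem existsUnique_correspondsTo_or_livesAt (𝒯 : FinSepTree G T) (ω : GraphEnd G) :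
    ∃! z : GraphEnd T ⊕ W, Sum.elim (𝒯.CorrespondsTo ω) (𝒯.LivesAt ω) z := by
  refine existsUnique_of_exists_of_unique ?_ ?_
  · by_cases h : ∃ t, 𝒯.LivesAt ω t
    · obtain ⟨t, ht⟩ := h
      exact ⟨Sum.inr t, ht⟩
    · obtain ⟨η, hη⟩ := exists_correspondsTo_of_forall_not_livesAt (not_exists.mp h)
      exact ⟨Sum.inl η, hη⟩
  · rintro (η | t) (η' | t') h h'
    · exact congrArg Sum.inl (h.unique h')
    · exact absurd h' (h.not_livesAt t')
    · exact absurd h (h'.not_livesAt t)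
    · exact congrArg Sum.inr (h.unique h')

theorem exists_isEndMap (𝒯 : FinSepTree G T) : ∃ τ, 𝒯.IsEndMap τ := by
  choose τ hτ hunique using 𝒯.existsUnique_correspondsTo_or_livesAt
  have hiff : ∀ ω z, τ ω = z ↔ Sum.elim (𝒯.CorrespondsTo ω) (𝒯.LivesAt ω) z :=
    fun ω z => ⟨fun h => h ▸ hτ ω, fun h => (hunique ω z h).symm⟩
  exact ⟨τ, fun ω η => hiff ω (Sum.inl η), fun ω t => hiff ω (Sum.inr t)⟩

theorem displays_of_forall_end {Ψ : Set (GraphEnd G)}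
    (hnode : ∀ ω ∈ Ψ, ∀ t, ¬ 𝒯.LivesAt ω t)
    (hend : ∀ η, ∃ ω ∈ Ψ, ∀ ω', 𝒯.CorrespondsTo ω' η ↔ ω' = ω) : 𝒯.Displays Ψ := by
  obtain ⟨τ, hcorr, hlive⟩ := 𝒯.exists_isEndMap
  refine ⟨τ, ⟨hcorr, hlive⟩, ⟨fun ω hω => ?_, fun ω _ ω' hω' heq => ?_, ?_⟩, fun ω hω => ?_⟩
  · rcases hz : τ ω with η | t
    · exact ⟨η, rfl⟩
    · exact absurd ((hlive ω t).mp hz) (hnode ω hω t)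
  · rcases hz : τ ω' with η | t
    · obtain ⟨ω₀, -, h₀⟩ := hend η
      exact ((h₀ ω).mp ((hcorr ω η).mp (heq.trans hz))).trans
        ((h₀ ω').mp ((hcorr ω' η).mp hz)).symm
    · exact absurd ((hlive ω' t).mp hz) (hnode ω' hω' t)
  · rintro _ ⟨η, rfl⟩
    obtain ⟨ω, hω, hωη⟩ := hend η
    exact ⟨ω, hω, (hcorr ω η).mpr ((hωη ω).mpr rfl)⟩
  · rcases hz : τ ω with η | t
    · obtain ⟨ω₀, hω₀, h₀⟩ := hend η
      exact absurd ((h₀ ω).mp ((hcorr ω η).mp hz) ▸ hω₀) hω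
    · exact ⟨t, rfl⟩

end FinSepTree

end EndMap

section Arborescence

variable {α : Type v} {P : α → α → Prop} {r x y z : α}

/-- `P x y`, read as "`x` is the parent of `y`", makes `α` a rooted tree with root `r`. -/
structure IsArborescence (P : α → α → Prop) (r : α) : Prop where
  reachable : ∀ x, Relation.ReflTransGen P r x
  parent_unique : ∀ {x y z}, P x z → P y z → x = y
  not_parent_root : ∀ x, ¬ P x r

namespace IsArborescence

theorem wellFounded (h : IsArborescence P r) : WellFounded P := by
  refine ⟨fun x => ?_⟩
  induction h.reachable x with
  | refl => exact ⟨_, fun y hy => absurd hy (h.not_parent_root y)⟩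
  | tail _ hyz ih => exact ⟨_, fun w hw => h.parent_unique hyz hw ▸ ih⟩

theorem asymm (h : IsArborescence P r) (hxy : P x y) : ¬ P y x :=
  h.wellFounded.asymmetric _ _ hxy

theorem ne_of_parent (h : IsArborescence P r) (hxy : P x y) : x ≠ y := by
  rintro rfl
  exact h.asymm hxy hxy

theorem adj_iff (h : IsArborescence P r) : (fromRel P).Adj x y ↔ P x y ∨ P y x := by
  rw [fromRel_adj]
  exact and_iff_right_of_imp fun h' => h'.elim h.ne_of_parent fun hyx => (h.ne_of_parent hyx).symm

theorem connected (h : IsArborescence P r) : (fromRel P).Connected := by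
  rw [connected_iff_exists_forall_reachable]
  refine ⟨r, fun x => ?_⟩
  induction h.reachable x with
  | refl => exact Reachable.refl _
  | tail _ hyz ih => exact ih.trans (Adj.reachable (h.adj_iff.mpr (Or.inl hyz)))

theorem reflTransGen_of_adj (h : IsArborescence P r) (hxy : Relation.ReflTransGen P x y)
    (hyz : (fromRel P).Adj y z) (hne : x ≠ y) : Relation.ReflTransGen P x z := by
  rcases h.adj_iff.mp hyz with hyz | hzy
  · exact hxy.tail hyz
  · obtain ⟨w, hxw, hwy⟩ := (Relation.ReflTransGen.cases_tail hxy).resolve_left hne.symm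
    exact h.parent_unique hwy hzy ▸ hxw

theorem isBridge (h : IsArborescence P r) (hxy : P x y) : (fromRel P).IsBridge s(x, y) := by
  rw [Sym2.eq_swap, isBridge_iff]
  rintro ⟨p⟩
  have hx : ¬ Relation.ReflTransGen P y x := fun hyx =>
    h.wellFounded.transGen.irrefl.irrefl y (.tail' hyx hxy)
  obtain ⟨⟨⟨a, b⟩, hab⟩, -, ha, hb⟩ :=
    p.exists_boundary_dart {z | Relation.ReflTransGen P y z} .refl hx
  obtain ⟨hab, hmem⟩ := deleteEdges_adj.mp hab
  obtain rfl : y = a := by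
    by_contra hne
    exact hb (h.reflTransGen_of_adj ha hab hne)
  rcases h.adj_iff.mp hab with hyb | hby
  · exact hb (.single hyb)
  · exact hmem (h.parent_unique hxy hby ▸ rfl)

theorem isTree (h : IsArborescence P r) : (fromRel P).IsTree := by
  refine ⟨h.connected, isAcyclic_iff_forall_adj_isBridge.mpr fun x y hxy => ?_⟩
  rcases h.adj_iff.mp hxy with hxy | hyx
  · exact h.isBridge hxy
  · exact Sym2.eq_swap ▸ h.isBridge hyx

theorem parent_succ_of_ray (h : IsArborescence P r) {R : Ray (fromRel P)} (h0 : R.vert 0 = r)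
    (n : ℕ) : P (R.vert n) (R.vert (n + 1)) := by
  induction n with
  | zero => exact (h.adj_iff.mp (R.adj 0)).resolve_right (h0 ▸ h.not_parent_root _)
  | succ n ih =>
    refine (h.adj_iff.mp (R.adj (n + 1))).resolve_right fun hp => ?_
    have := R.injective (h.parent_unique ih hp)
    omega

end IsArborescence

end Arborescence

section TreeOfSeparations

variable {V : Type u} {W : Type v} {G : SimpleGraph V} {T : SimpleGraph W}

theorem FinSep.le_refl (s : FinSep G) : s ≤ s := ⟨subset_rfl, subset_rfl⟩

theorem FinSep.le_trans {s t w : FinSep G} (h : s ≤ t) (h' : t ≤ w) : s ≤ w :=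
  ⟨h.1.trans h'.1, h'.2.trans h.2⟩

theorem FinSep.inv_le_inv {s t : FinSep G} (h : s ≤ t) : t.inv ≤ s.inv := ⟨h.2, h.1⟩

theorem FinSep.separator_inv (s : FinSep G) : s.inv.separator = s.separator :=
  Set.inter_comm _ _

theorem map_le_of_forall_consecutive {α : T.Dart → FinSep G}
    (h : ∀ {x y z : W} (hxy : T.Adj x y) (hyz : T.Adj y z), x ≠ z →
      α ⟨(x, y), hxy⟩ ≤ α ⟨(y, z), hyz⟩) {d d' : T.Dart} (hd : EdgeLE d d') : α d ≤ α d' := by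
  rcases hd with rfl | ⟨p, hp⟩
  · exact FinSep.le_refl _
  obtain ⟨⟨x, y⟩, hxy⟩ := d
  obtain ⟨⟨z, w⟩, hzw⟩ := d'
  simp only at p hp hxy hzw
  induction p generalizing x with
  | nil =>
    refine h hxy hzw ?_
    rintro rfl
    simp [Walk.concat_eq_append] at hp
  | @cons y y' z hyy' p ih =>
    rw [Walk.concat_cons] at hp
    refine FinSep.le_trans (h hxy hyy' ?_) (ih _ hyy' hzw hp.of_cons)
    rintro rfl
    exact ((Walk.cons_isPath_iff _ _).mp hp).2 (by simp)

namespace IsArborescence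

variable {P : W → W → Prop} {r x y : W}

open Classical in
/-- The map from the oriented edges of a rooted tree to separations that sends the edge from the
parent of a node `y` to `y` to `s y`, and the reverse edge to the inverse of `s y`. -/
noncomputable def dartSep (P : W → W → Prop) (s : W → FinSep G) (d : (fromRel P).Dart) :
    FinSep G :=
  if P d.fst d.snd then s d.snd else (s d.fst).inv

theorem dartSep_of_parent {s : W → FinSep G} {d : (fromRel P).Dart} (hd : P d.fst d.snd) :
    dartSep P s d = s d.snd := if_pos hd

theorem dartSep_of_child (h : IsArborescence P r) {s : W → FinSep G} {d : (fromRel P).Dart}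
    (hd : P d.snd d.fst) : dartSep P s d = (s d.fst).inv := if_neg (h.asymm hd)

/-- The tree of separations on a rooted tree in which the edge from the parent of a node `y` to `y`
is mapped to `s y`. -/
noncomputable def finSepTree (h : IsArborescence P r) (s : W → FinSep G)
    (hs : ∀ ⦃x y z⦄, P x y → P y z → s y ≤ s z)
    (hs' : ∀ ⦃x y z⦄, P x y → P x z → y ≠ z → (s y).inv ≤ s z) : FinSepTree G (fromRel P) where
  isTree := h.isTree
  α := dartSep P s
  map_symm d := by
    rcases h.adj_iff.mp d.adj with hd | hd
    · rw [dartSep_of_parent hd]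
      exact h.dartSep_of_child (d := d.symm) hd
    · rw [h.dartSep_of_child hd]
      exact dartSep_of_parent (d := d.symm) hd
  map_le _ _ := by
    refine map_le_of_forall_consecutive fun {x y z} hxy hyz hne => ?_
    rcases h.adj_iff.mp hxy with hd | hd <;> rcases h.adj_iff.mp hyz with hd' | hd'
    · rw [dartSep_of_parent hd, dartSep_of_parent hd']
      exact hs hd hd'
    · exact absurd (h.parent_unique hd hd') hne
    · rw [h.dartSep_of_child hd, dartSep_of_parent hd']
      exact hs' hd hd' hne
    · rw [h.dartSep_of_child hd, h.dartSep_of_child hd']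
      exact FinSep.inv_le_inv (hs hd' hd)

variable {h : IsArborescence P r} {s : W → FinSep G}
  {hs : ∀ ⦃x y z⦄, P x y → P y z → s y ≤ s z}
  {hs' : ∀ ⦃x y z⦄, P x y → P x z → y ≠ z → (s y).inv ≤ s z} {ω : GraphEnd G}

theorem orients_iff (hxy : P x y) (hadj : (fromRel P).Adj x y) :
    (h.finSepTree s hs hs').Orients ω ⟨(x, y), hadj⟩ ↔ ω.LivesIn (s y).B := by
  rw [← dartSep_of_parent (s := s) (d := ⟨(x, y), hadj⟩) hxy]
  rfl

theorem exists_parent_separator_eq (d : (fromRel P).Dart) :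
    ∃ x y, P x y ∧ d.edge = s(x, y) ∧
      ((h.finSepTree s hs hs').α d).separator = (s y).separator := by
  rcases h.adj_iff.mp d.adj with hd | hd
  · exact ⟨d.fst, d.snd, hd, rfl, congrArg FinSep.separator (dartSep_of_parent hd)⟩
  · exact ⟨d.snd, d.fst, hd, Sym2.eq_swap,
      (congrArg FinSep.separator (h.dartSep_of_child hd)).trans (FinSep.separator_inv _)⟩

end IsArborescence

end TreeOfSeparations

section Parts

variable {V : Type u} {G : SimpleGraph V} {Ψ : Set (GraphEnd G)} {S : Set V → Finset V}
  {C D E : Set V}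

/-- A part is a region in which some end in `Ψ` lives. -/
def IsPart (Ψ : Set (GraphEnd G)) (C : Set V) : Prop :=
  IsRegion G C ∧ ∃ ω ∈ Ψ, ω.LivesIn C

/-- `D` is a part that arises from `C` by deleting `S C`: it is a component of `G - S C` that is
contained in `C` and in which some end in `Ψ` lives. -/
def IsChildPart (Ψ : Set (GraphEnd G)) (S : Set V → Finset V) (C D : Set V) : Prop :=
  (∃ K : G.ComponentCompl (S C : Set V), (K : Set V) = D) ∧ D ⊆ C ∧ ∃ ω ∈ Ψ, ω.LivesIn D

/-- `S` assigns to each part `C` a connected finite set `S C ⊆ C` that separates, inside `C`, the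
complement of `C` from all ends in `Ψ` that live in `C`. The set `Set.univ`, from which the
decomposition starts, need not be a part, as `G` may be disconnected. -/
structure IsSeparatorChoice (Ψ : Set (GraphEnd G)) (S : Set V → Finset V) : Prop where
  subset : ∀ C, (S C : Set V) ⊆ C
  connected : ∀ {C}, IsPart Ψ C → (G.induce (S C : Set V)).Connected
  exists_child : ∀ {C}, C = Set.univ ∨ IsPart Ψ C → ∀ ω ∈ Ψ, ω.LivesIn C →
    ∃ D, IsChildPart Ψ S C D ∧ ω.LivesIn D

theorem exists_isSeparatorChoice (hcpt : IsCompact Ψ) (hund : ∀ ω ∈ Ψ, ω.Undominated) :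
    ∃ S : Set V → Finset V, IsSeparatorChoice Ψ S := by
  have h : ∀ C : Set V, ∃ S : Finset V, (S : Set V) ⊆ C ∧
      (IsPart Ψ C → (G.induce (S : Set V)).Connected) ∧
      (C = Set.univ ∨ IsPart Ψ C → ∀ ω ∈ Ψ, ω.LivesIn C →
        ∃ D : G.ComponentCompl (S : Set V), (D : Set V) ⊆ C ∧ ω.LivesIn (D : Set V)) := by
    intro C
    by_cases hC : IsPart Ψ C
    · obtain ⟨S, hSC, hS, hsep⟩ := exists_connected_finset_separating hcpt hund hC.1
      exact ⟨S, hSC, fun _ => hS, fun _ => hsep⟩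
    · refine ⟨∅, by simp, fun h => absurd h hC, fun h ω _ _ => ?_⟩
      obtain ⟨D, hD⟩ := ω.exists_component ∅
      exact ⟨D, h.resolve_right hC ▸ Set.subset_univ _, hD⟩
  choose S hsub hconn hsep using h
  refine ⟨S, hsub, fun {C} => hconn C, fun {C} hC ω hω hωC => ?_⟩
  obtain ⟨D, hD, hωD⟩ := hsep C hC ω hω hωC
  exact ⟨D, ⟨⟨D, rfl⟩, hD, ω, hω, hωD⟩, hωD⟩

namespace IsChildPart

theorem isPart (h : IsChildPart Ψ S C D) : IsPart Ψ D := ⟨⟨S C, h.1⟩, h.2.2⟩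

theorem subset (h : IsChildPart Ψ S C D) : D ⊆ C := h.2.1

theorem mem_of_adj (h : IsChildPart Ψ S C D) {a b : V} (ha : a ∈ D) (hb : b ∉ S C)
    (hab : G.Adj a b) : b ∈ D := by
  obtain ⟨⟨K, rfl⟩, -⟩ := h
  exact ComponentCompl.mem_of_adj a b ha hb hab

theorem disjoint_separator (h : IsChildPart Ψ S C D) : Disjoint (S C : Set V) D := by
  obtain ⟨⟨K, rfl⟩, -⟩ := h
  exact K.disjoint_right

theorem eq_of_mem (h : IsChildPart Ψ S C D) (h' : IsChildPart Ψ S C E) {v : V} (hD : v ∈ D)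
    (hE : v ∈ E) : D = E := by
  obtain ⟨⟨K, rfl⟩, -⟩ := h
  obtain ⟨⟨L, rfl⟩, -⟩ := h'
  by_contra hne
  exact Set.disjoint_iff.mp (ComponentCompl.pairwise_disjoint fun h => hne (by rw [h])) ⟨hD, hE⟩

theorem ssubset (h : IsChildPart Ψ S C D) (hS : IsSeparatorChoice Ψ S) : D ⊂ C := by
  refine h.subset.ssubset_of_ne ?_
  rintro rfl
  obtain ⟨v, hv⟩ := (hS.connected h.isPart).nonempty
  exact Set.disjoint_left.mp h.disjoint_separator hv (hS.subset _ hv)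

end IsChildPart

theorem finite_setOf_isChildPart (hcpt : IsCompact Ψ) (C : Set V) :
    {D | IsChildPart Ψ S C D}.Finite := by
  refine ((finite_setOf_component_livesIn hcpt (S C)).image
    fun K : G.ComponentCompl (S C : Set V) => (K : Set V)).subset ?_
  rintro D ⟨⟨K, rfl⟩, -, h⟩
  exact ⟨K, h, rfl⟩

theorem subset_of_reflTransGen (h : Relation.ReflTransGen (IsChildPart Ψ S) C D) : D ⊆ C := by
  induction h with
  | refl => exact subset_rfl
  | tail _ h ih => exact h.subset.trans ih

theorem reflTransGen_or_of_mem (hC : Relation.ReflTransGen (IsChildPart Ψ S) E C)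
    (hD : Relation.ReflTransGen (IsChildPart Ψ S) E D) {v : V} (hvC : v ∈ C) (hvD : v ∈ D) :
    Relation.ReflTransGen (IsChildPart Ψ S) C D ∨
      Relation.ReflTransGen (IsChildPart Ψ S) D C := by
  induction hC with
  | refl => exact Or.inl hD
  | tail _ hBC ih =>
    rcases ih (hBC.subset hvC) with hBD | hDB
    · rcases hBD.cases_head with rfl | ⟨F, hBF, hFD⟩
      · exact Or.inr (.single hBC)
      · exact Or.inl (hBC.eq_of_mem hBF hvC (subset_of_reflTransGen hFD hvD) ▸ hFD)
    · exact Or.inr (hDB.tail hBC)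

theorem disjoint_separator_of_reflTransGen (hS : IsSeparatorChoice Ψ S)
    (h : Relation.ReflTransGen (IsChildPart Ψ S) C D) (hne : C ≠ D) :
    Disjoint (S C : Set V) (S D) := by
  obtain ⟨E, hCE, hED⟩ := h.cases_head.resolve_left hne
  exact hCE.disjoint_separator.mono_right ((hS.subset D).trans (subset_of_reflTransGen hED))

theorem eq_of_isChildPart_of_reflTransGen (hS : IsSeparatorChoice Ψ S)
    (hCE : IsChildPart Ψ S C E) (hDE : IsChildPart Ψ S D E)
    (hCD : Relation.ReflTransGen (IsChildPart Ψ S) C D) : C = D := by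
  rcases hCD.cases_head with rfl | ⟨F, hCF, hFD⟩
  · rfl
  obtain ⟨ω, -, hω⟩ := hCE.isPart.2
  obtain ⟨v, hv⟩ := hω.nonempty
  have hEF : E = F := hCE.eq_of_mem hCF hv (subset_of_reflTransGen hFD (hDE.subset hv))
  exact absurd (hEF ▸ subset_of_reflTransGen hFD) (hDE.ssubset hS).not_subset

theorem iInter_eq_empty_of_isChildPart (hS : IsSeparatorChoice Ψ S) {C : ℕ → Set V}
    (hC : ∀ n, IsChildPart Ψ S (C n) (C (n + 1))) : ⋂ n, C n = ∅ := by
  by_contra! hne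
  obtain ⟨K, hK⟩ := (hC 0).1
  have hsub : C 1 ⊆ ⋂ n, C n := by
    rw [← hK]
    refine componentCompl_subset_of_closed K ?_ fun a ha _ b _ hab =>
      Set.mem_iInter.mpr fun n => ?_
    · rwa [hK, Set.inter_eq_right.mpr (Set.iInter_subset C 1)]
    by_cases hb : b ∈ S (C n)
    · exact hS.subset _ hb
    · exact (hC n).subset ((hC n).mem_of_adj (Set.mem_iInter.mp ha (n + 1)) hb hab)
  obtain ⟨v, hv⟩ := (hS.connected (hC 0).isPart).nonempty
  exact Set.disjoint_left.mp (hC 1).disjoint_separator hv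
    (Set.mem_iInter.mp (hsub (hS.subset _ hv)) 2)

theorem exists_end_forall_livesIn_iff (hcpt : IsCompact Ψ) (hS : IsSeparatorChoice Ψ S)
    {C : ℕ → Set V} (hC : ∀ n, IsChildPart Ψ S (C n) (C (n + 1))) :
    ∃ ω ∈ Ψ, ∀ ω' : GraphEnd G, (∀ n, ω'.LivesIn (C n)) ↔ ω' = ω := by
  have hmono : Antitone fun n => C (n + 1) := antitone_nat_of_succ_le fun n => (hC (n + 1)).subset
  have hregion : ∀ n, IsRegion G (C (n + 1)) := fun n => (hC n).isPart.1
  obtain ⟨ω, hω, hωC⟩ := exists_end_livesIn_antitone hcpt hregion hmono fun n => (hC n).isPart.2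
  refine ⟨ω, hω, fun ω' => ⟨fun h => ?_, ?_⟩⟩
  · exact end_unique_of_iInter_eq_empty hregion hmono
      (iInter_eq_empty_of_isChildPart hS fun n => hC (n + 1)) (fun n => h (n + 1)) hωC
  · rintro rfl n
    exact (hωC n).mono (hC n).subset

/-- The separation that splits the children of `C` off the rest of the graph. -/
def partSep (Ψ : Set (GraphEnd G)) (S : Set V → Finset V) (C : Set V) : FinSep G where
  A := (⋃₀ {D | IsChildPart Ψ S C D})ᶜ
  B := S C ∪ ⋃₀ {D | IsChildPart Ψ S C D}
  union_eq := by
    rw [Set.union_left_comm, Set.compl_union_self, Set.union_univ]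
  no_edge := by
    rintro a ⟨haA, haB⟩ b ⟨-, hbA⟩ hab
    obtain ⟨D, hD, hbD⟩ := not_not.mp hbA
    exact haA ⟨D, hD, hD.mem_of_adj hbD (fun h => haB (Or.inl h)) hab.symm⟩
  finite_order := (S C).finite_toSet.subset fun x hx => hx.2.resolve_right hx.1

theorem partSep_separator (C : Set V) : (partSep Ψ S C).separator = S C := by
  refine Set.Subset.antisymm (fun x hx => hx.2.resolve_right hx.1) fun x hx => ⟨?_, Or.inl hx⟩
  rintro ⟨D, hD, hxD⟩
  exact Set.disjoint_left.mp hD.disjoint_separator hx hxD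

theorem partSep_subset (hS : IsSeparatorChoice Ψ S) : (partSep Ψ S C).B ⊆ C :=
  Set.union_subset (hS.subset C) (Set.sUnion_subset fun _ hD => hD.subset)

theorem compl_partSep_subset : (partSep Ψ S C).Aᶜ ⊆ C :=
  (compl_compl _).subset.trans (Set.sUnion_subset fun _ hD => hD.subset)

namespace IsChildPart

theorem subset_partSep (h : IsChildPart Ψ S C D) : D ⊆ (partSep Ψ S C).B :=
  (Set.subset_sUnion_of_mem h).trans Set.subset_union_right

theorem partSep_le (h : IsChildPart Ψ S C D) (hS : IsSeparatorChoice Ψ S) :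
    partSep Ψ S C ≤ partSep Ψ S D := by
  refine ⟨?_, (partSep_subset hS).trans h.subset_partSep⟩
  rw [← Set.compl_subset_compl]
  exact compl_partSep_subset.trans
    ((Set.subset_sUnion_of_mem h).trans (compl_compl _).symm.subset)

theorem partSep_inv_le (hD : IsChildPart Ψ S C D) (hE : IsChildPart Ψ S C E) (hne : D ≠ E)
    (hS : IsSeparatorChoice Ψ S) : (partSep Ψ S D).inv ≤ partSep Ψ S E := by
  have key : ∀ {D E : Set V}, IsChildPart Ψ S C D → IsChildPart Ψ S C E → D ≠ E →
      (partSep Ψ S D).B ⊆ (partSep Ψ S E).A := by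
    intro D E hD hE hne x hx
    by_contra hxA
    exact hne (hD.eq_of_mem hE (partSep_subset hS hx) (compl_partSep_subset hxA))
  exact ⟨key hD hE hne, key hE hD hne.symm⟩

end IsChildPart

end Parts

section PartTree

variable {V : Type u} {G : SimpleGraph V} {Ψ : Set (GraphEnd G)} {S : Set V → Finset V}

/-- The nodes of the decomposition tree: `Set.univ` and the parts obtained from it by repeatedly
passing to a child. -/
abbrev PartNode (Ψ : Set (GraphEnd G)) (S : Set V → Finset V) : Type u :=
  {C : Set V // Relation.ReflTransGen (IsChildPart Ψ S) Set.univ C}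

namespace PartNode

/-- The parent relation of the decomposition tree. -/
def IsParent (C D : PartNode Ψ S) : Prop := IsChildPart Ψ S C D

/-- The root of the decomposition tree. -/
def root : PartNode Ψ S := ⟨Set.univ, .refl⟩

theorem eq_root_or_exists_isParent (C : PartNode Ψ S) :
    C = root ∨ ∃ B : PartNode Ψ S, B.IsParent C := by
  rcases C.2.cases_tail with h | ⟨B, hB, hBC⟩
  · exact Or.inl (Subtype.ext h)
  · exact Or.inr ⟨⟨B, hB⟩, hBC⟩

theorem eq_univ_or_isPart (C : PartNode Ψ S) : (C : Set V) = Set.univ ∨ IsPart Ψ (C : Set V) :=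
  C.eq_root_or_exists_isParent.imp (congrArg Subtype.val) fun ⟨_, h⟩ => h.isPart

theorem exists_isParent_livesIn (hS : IsSeparatorChoice Ψ S) (C : PartNode Ψ S) {ω : GraphEnd G}
    (hω : ω ∈ Ψ) (hC : ω.LivesIn C) : ∃ D : PartNode Ψ S, C.IsParent D ∧ ω.LivesIn D := by
  obtain ⟨D, hD, hωD⟩ := hS.exists_child C.eq_univ_or_isPart ω hω hC
  exact ⟨⟨D, C.2.tail hD⟩, hD, hωD⟩

theorem isArborescence (hS : IsSeparatorChoice Ψ S) :
    IsArborescence (IsParent (Ψ := Ψ) (S := S)) root where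
  reachable := by
    rintro ⟨C, hC⟩
    induction hC with
    | refl => exact .refl
    | tail hB hBC ih => exact ih.tail hBC
  parent_unique := by
    intro C D E hCE hDE
    obtain ⟨ω, -, hω⟩ := hCE.isPart.2
    obtain ⟨v, hv⟩ := hω.nonempty
    rcases reflTransGen_or_of_mem C.2 D.2 (hCE.subset hv) (hDE.subset hv) with h | h
    · exact Subtype.ext (eq_of_isChildPart_of_reflTransGen hS hCE hDE h)
    · exact Subtype.ext (eq_of_isChildPart_of_reflTransGen hS hDE hCE h).symm
  not_parent_root C h := (h.ssubset hS).not_subset (Set.subset_univ _)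

theorem disjoint_separator (hS : IsSeparatorChoice Ψ S) {C D : PartNode Ψ S} (hne : C ≠ D) :
    Disjoint (S C : Set V) (S D) := by
  have hne' := Subtype.coe_ne_coe.mpr hne
  by_contra hmeet
  obtain ⟨v, hvC, hvD⟩ := Set.not_disjoint_iff.mp hmeet
  rcases reflTransGen_or_of_mem C.2 D.2 (hS.subset _ hvC) (hS.subset _ hvD) with h | h
  · exact hmeet (disjoint_separator_of_reflTransGen hS h hne')
  · exact hmeet (disjoint_separator_of_reflTransGen hS h hne'.symm).symm

end PartNode

open PartNode

/-- The decomposition tree, in which the edge from `C` to its child `D` is mapped to the separation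
that splits the children of `D` off the rest of the graph. -/
noncomputable def partTree (hS : IsSeparatorChoice Ψ S) :
    FinSepTree G (fromRel (IsParent (Ψ := Ψ) (S := S))) :=
  (isArborescence hS).finSepTree (fun C => partSep Ψ S C) (fun _ _ _ _ h => h.partSep_le hS)
    fun _ _ _ h h' hne => h.partSep_inv_le h' (Subtype.coe_ne_coe.mpr hne) hS

theorem exists_isParent_partTree_separator_eq (hS : IsSeparatorChoice Ψ S)
    (d : (fromRel (IsParent (Ψ := Ψ) (S := S))).Dart) :
    ∃ C D : PartNode Ψ S, C.IsParent D ∧ d.edge = s(C, D) ∧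
      ((partTree hS).α d).separator = S D := by
  obtain ⟨C, D, hCD, hd, h⟩ := IsArborescence.exists_parent_separator_eq d
  exact ⟨C, D, hCD, hd, h.trans (partSep_separator _)⟩

theorem partTree_isLocallyFinite (hcpt : IsCompact Ψ) (hS : IsSeparatorChoice Ψ S) :
    (partTree hS).IsLocallyFinite := by
  intro C
  have hchild : {D : PartNode Ψ S | C.IsParent D}.Finite :=
    (finite_setOf_isChildPart hcpt C).preimage Subtype.val_injective.injOn
  have hparent : {B : PartNode Ψ S | B.IsParent C}.Finite :=
    Set.Subsingleton.finite fun _ hB _ hB' => (isArborescence hS).parent_unique hB hB'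
  exact (hchild.union hparent).subset fun D hD => (isArborescence hS).adj_iff.mp hD

theorem partTree_connectedSeparators (hS : IsSeparatorChoice Ψ S) :
    (partTree hS).ConnectedSeparators := by
  intro d
  obtain ⟨C, D, hCD, -, h⟩ := exists_isParent_partTree_separator_eq hS d
  exact h ▸ hS.connected hCD.isPart

theorem partTree_disjointSeparators (hS : IsSeparatorChoice Ψ S) :
    (partTree hS).DisjointSeparators := by
  intro d d' hne
  obtain ⟨C, D, hCD, hd, h⟩ := exists_isParent_partTree_separator_eq hS d
  obtain ⟨C', D', hCD', hd', h'⟩ := exists_isParent_partTree_separator_eq hS d'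
  rw [h, h']
  refine disjoint_separator hS ?_
  rintro rfl
  exact hne (by rw [hd, hd', (isArborescence hS).parent_unique hCD hCD'])

theorem partTree_orients_iff (hS : IsSeparatorChoice Ψ S) {C D : PartNode Ψ S}
    (hCD : C.IsParent D) (hadj : (fromRel IsParent).Adj C D) (ω : GraphEnd G) :
    (partTree hS).Orients ω ⟨(C, D), hadj⟩ ↔ ω.LivesIn (partSep Ψ S D).B :=
  IsArborescence.orients_iff hCD hadj

theorem livesIn_of_partTree_livesAt (hS : IsSeparatorChoice Ψ S) {ω : GraphEnd G}
    {C : PartNode Ψ S} (h : (partTree hS).LivesAt ω C) : ω.LivesIn C := by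
  rcases C.eq_root_or_exists_isParent with rfl | ⟨B, hBC⟩
  · exact ω.livesIn_univ
  · have hadj := (isArborescence hS).adj_iff.mpr (Or.inl hBC)
    exact ((partTree_orients_iff hS hBC hadj ω).mp (h _ rfl)).mono (partSep_subset hS)

theorem not_partTree_livesAt (hS : IsSeparatorChoice Ψ S) {ω : GraphEnd G} (hω : ω ∈ Ψ)
    (C : PartNode Ψ S) : ¬ (partTree hS).LivesAt ω C := by
  intro h
  obtain ⟨D, hCD, hωD⟩ := C.exists_isParent_livesIn hS hω (livesIn_of_partTree_livesAt hS h)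
  obtain ⟨E, hDE, hωE⟩ := D.exists_isParent_livesIn hS hω hωD
  have hadj := (isArborescence hS).adj_iff.mpr (Or.inl hCD)
  exact h.not_orients hadj
    ((partTree_orients_iff hS hCD hadj ω).mpr (hωE.mono hDE.subset_partSep))

theorem partTree_correspondsTo_iff (hS : IsSeparatorChoice Ψ S)
    {η : GraphEnd (fromRel (IsParent (Ψ := Ψ) (S := S)))}
    {R : Ray (fromRel (IsParent (Ψ := Ψ) (S := S)))} (hR : η.HasRay R)
    (hchain : ∀ n, (R.vert n).IsParent (R.vert (n + 1))) (ω : GraphEnd G) :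
    (partTree hS).CorrespondsTo ω η ↔ ∀ n, ω.LivesIn (R.vert n) := by
  have horients n := partTree_orients_iff hS (hchain n) (R.adj n) ω
  constructor
  · intro h n
    exact (((horients n).mp (h.orients hR n)).mono (partSep_subset hS)).mono (hchain n).subset
  · exact fun h => ⟨R, hR, fun n =>
      (horients n).mpr ((h (n + 2)).mono (hchain (n + 1)).subset_partSep)⟩

theorem partTree_displays (hcpt : IsCompact Ψ) (hS : IsSeparatorChoice Ψ S) :
    (partTree hS).Displays Ψ := by
  refine FinSepTree.displays_of_forall_end (fun ω hω => not_partTree_livesAt hS hω) fun η => ?_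
  obtain ⟨R, hR, hroot⟩ :=
    exists_hasRay_vert_zero_eq (isArborescence hS).connected.preconnected η root
  have hchain := (isArborescence hS).parent_succ_of_ray hroot
  obtain ⟨ω, hω, hunique⟩ := exists_end_forall_livesIn_iff hcpt hS hchain
  exact ⟨ω, hω, fun ω' => (partTree_correspondsTo_iff hS hR hchain ω').trans (hunique ω')⟩

end PartTree

end InfGraph

theorem proposition4p4_general {V : Type u} (G : SimpleGraph V) (Ψ : Set (InfGraph.GraphEnd G))
    (hcpt : IsCompact Ψ) (hund : ∀ ω ∈ Ψ, ω.Undominated) :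
    ∃ (W : Type u) (T : SimpleGraph W) (𝒯 : InfGraph.FinSepTree G T),
      𝒯.IsLocallyFinite ∧ 𝒯.ConnectedSeparators ∧ 𝒯.DisjointSeparators ∧ 𝒯.Displays Ψ := by
  obtain ⟨S, hS⟩ := InfGraph.exists_isSeparatorChoice hcpt hund
  exact ⟨_, _, InfGraph.partTree hS, InfGraph.partTree_isLocallyFinite hcpt hS,
    InfGraph.partTree_connectedSeparators hS, InfGraph.partTree_disjointSeparators hS,
    InfGraph.partTree_displays hcpt hS⟩

theorem proposition4p4 {V : Type u} (G : SimpleGraph V) (hG : G.Connected)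
    (Ψ : Set (InfGraph.GraphEnd G)) (hne : Ψ.Nonempty) (hcpt : IsCompact Ψ)
    (hund : ∀ ω ∈ Ψ, ω.Undominated) :
    ∃ (W : Type u) (T : SimpleGraph W) (𝒯 : InfGraph.FinSepTree G T),
      𝒯.IsLocallyFinite ∧ 𝒯.ConnectedSeparators ∧ 𝒯.DisjointSeparators ∧ 𝒯.Displays Ψ :=
  proposition4p4_general G Ψ hcpt hund
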